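/- Let $\Omega \subset \mathbb{R}^2$ be a bounded domain (nonempty, open and connected) with Lipschitz boundary. Write $\|\cdot\|_1$ for the norm of $L^1(\Omega)$ taken with the Euclidean norm for vectors and the Frobenius norm for matrices, $\|\varphi\|_{W^{1,1}} = \|\varphi\|_1 + \|\nabla\varphi\|_1$, where $\nabla\varphi$ is the weak gradient, and $$\mathrm{TV}(u) = \sup\Bigl\{\int_\Omega \langle u, \operatorname{div}\psi\rangle \,\mathrm{d}x : \psi \in C^1_c(\Omega),\ \|\psi\|_\infty \le 1\Bigr\},$$ where $\psi$ takes values in the tensors of one order higher than those of $u$ and $(\operatorname{div}\psi)_i = \sum_j \partial_j \psi_{j,i}$. Let $\mathrm{BV}(\Omega,\mathbb{R}^{2\times 2})$ be the space of all $w \in L^1(\Omega,\mathbb{R}^{2\times 2})$ with $\mathrm{TV}(w) < \infty$, and let $\mathrm{BV}^2(\Omega,\mathbb{R}^2)$ be the space of all $\varphi \in W^{1,1}(\Omega,\mathbb{R}^2)$ with $\nabla\varphi \in \mathrm{BV}(\Omega,\mathbb{R}^{2\times 2})$. Then there is a constant $C > 0$ (depending only on $\Omega$) such that for all $\varphi \in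 \mathrm{BV}^2(\Omega,\mathbb{R}^2)$ and all $w \in \mathrm{BV}(\Omega,\mathbb{R}^{2\times 2})$, $$\|\varphi\|_{W^{1,1}} \le C\bigl(\|\varphi\|_1 + \|\nabla\varphi - w\|_1 + \mathrm{TV}(w)\bigr).$$ In particular, $\|\varphi\|_{W^{1,1}} \le C\bigl(\|\varphi\|_1 + \mathrm{TV}(\nabla\varphi)\bigr)$ for all $\varphi \in \mathrm{BV}^2(\Omega,\mathbb{R}^2)$. -/

import Mathlib

open MeasureTheory TopologicalSpace
open scoped ENNReal NNReal Distributions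

noncomputable section

namespace BVPlane

/-- A bounded open set of the plane (boundedness is required separately) has Lipschitz boundary if
near every boundary point, after an isometric linear change of coordinates, it is the set of points
lying strictly above the graph of a Lipschitz function of one variable. -/
def HasLipschitzBoundary (Ω : Opens (EuclideanSpace ℝ (Fin 2))) : Prop :=
  ∀ x₀ ∈ frontier (Ω : Set (EuclideanSpace ℝ (Fin 2))),
    ∃ (A : EuclideanSpace ℝ (Fin 2) ≃ₗᵢ[ℝ] EuclideanSpace ℝ (Fin 2)) (γ : ℝ → ℝ) (K : ℝ≥0) (r : ℝ),
      LipschitzWith K γ ∧ 0 < r ∧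
        ∀ x ∈ Metric.ball x₀ r, x ∈ Ω ↔ γ (A x 0) < A x 1

/-- A bounded domain (nonempty, open, connected, bounded) with Lipschitz boundary in the plane. -/
structure IsBoundedLipschitzDomain (Ω : Opens (EuclideanSpace ℝ (Fin 2))) : Prop where
  isConnected : IsConnected (Ω : Set (EuclideanSpace ℝ (Fin 2)))
  isBounded : Bornology.IsBounded (Ω : Set (EuclideanSpace ℝ (Fin 2)))
  lipschitzBoundary : HasLipschitzBoundary Ω

/- Tensor fields on `ℝ^d` are functions with values in `EuclideanSpace ℝ ι`, where `ι` indexes the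
coefficients, so that the Euclidean norm is the Frobenius norm: vectors in `ℝ^2` have `ι = Fin 2`,
`2 × 2` matrices have `ι = Fin 2 × Fin 2`. A gradient carries one more index, the index of the
differentiated variable, which is placed first. -/

variable {d : ℕ} {ι : Type} [Fintype ι]

/-- The divergence `(div ψ)_i = ∑_j ∂_j ψ_{j,i}`. -/
def divergence (ψ : EuclideanSpace ℝ (Fin d) → EuclideanSpace ℝ (Fin d × ι))
    (x : EuclideanSpace ℝ (Fin d)) : EuclideanSpace ℝ ι :=
  WithLp.toLp 2 fun i => ∑ j : Fin d, (fderiv ℝ ψ x (EuclideanSpace.single j 1)) (j, i)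

/-- The norm of `L¹(Ω)`, the integral over `Ω` of the Frobenius norm. -/
def normL1 (Ω : Opens (EuclideanSpace ℝ (Fin d)))
    (u : EuclideanSpace ℝ (Fin d) → EuclideanSpace ℝ ι) : ℝ≥0∞ :=
  eLpNorm u 1 (volume.restrict (Ω : Set (EuclideanSpace ℝ (Fin d))))

/-- Membership in `L¹(Ω)`. Only the values on `Ω` matter. -/
def MemL1 (Ω : Opens (EuclideanSpace ℝ (Fin d)))
    (u : EuclideanSpace ℝ (Fin d) → EuclideanSpace ℝ ι) : Prop :=
  MemLp u 1 (volume.restrict (Ω : Set (EuclideanSpace ℝ (Fin d))))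

/-- The total variation of `u`: the supremum of `∫_Ω ⟨u, div ψ⟩` over all compactly supported `C¹`
fields `ψ` on `Ω` with `‖ψ‖_∞ ≤ 1`. The supremum is nonnegative, since `ψ = 0` is admissible, so
that nothing is lost by `ENNReal.ofReal`. -/
def TV (Ω : Opens (EuclideanSpace ℝ (Fin d)))
    (u : EuclideanSpace ℝ (Fin d) → EuclideanSpace ℝ ι) : ℝ≥0∞ :=
  ⨆ (ψ : 𝓓^{1}(Ω, EuclideanSpace ℝ (Fin d × ι))) (_ : ∀ x, ‖ψ x‖ ≤ 1),
    ENNReal.ofReal (∫ x in (Ω : Set (EuclideanSpace ℝ (Fin d))), inner ℝ (u x) (divergence ψ x))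

/-- `u ∈ BV(Ω)`. -/
def MemBV (Ω : Opens (EuclideanSpace ℝ (Fin d)))
    (u : EuclideanSpace ℝ (Fin d) → EuclideanSpace ℝ ι) : Prop :=
  MemL1 Ω u ∧ TV Ω u < ∞

/-- The field `g ∈ L¹(Ω)` with `g_{j,i} = ∂_j u_i` in the weak sense on `Ω`. -/
def IsWeakGradient (Ω : Opens (EuclideanSpace ℝ (Fin d)))
    (u : EuclideanSpace ℝ (Fin d) → EuclideanSpace ℝ ι)
    (g : EuclideanSpace ℝ (Fin d) → EuclideanSpace ℝ (Fin d × ι)) : Prop :=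
  MemL1 Ω g ∧ ∀ ψ : 𝓓^{1}(Ω, EuclideanSpace ℝ (Fin d × ι)),
    ∫ x in (Ω : Set (EuclideanSpace ℝ (Fin d))), inner ℝ (u x) (divergence ψ x) =
      -∫ x in (Ω : Set (EuclideanSpace ℝ (Fin d))), inner ℝ (g x) (ψ x)

/-- `u ∈ W^{1,1}(Ω)`. -/
def MemW11 (Ω : Opens (EuclideanSpace ℝ (Fin d)))
    (u : EuclideanSpace ℝ (Fin d) → EuclideanSpace ℝ ι) : Prop :=
  MemL1 Ω u ∧ ∃ g, IsWeakGradient Ω u g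

open Classical in
/-- The weak gradient `∇u` of `u ∈ W^{1,1}(Ω)` (and zero where there is none). By
`IsWeakGradient.ae_eq` it is well defined up to a null set. -/
def weakGradient (Ω : Opens (EuclideanSpace ℝ (Fin d)))
    (u : EuclideanSpace ℝ (Fin d) → EuclideanSpace ℝ ι) :
    EuclideanSpace ℝ (Fin d) → EuclideanSpace ℝ (Fin d × ι) :=
  if h : ∃ g, IsWeakGradient Ω u g then h.choose else 0

/-- The norm of `W^{1,1}(Ω)`. -/
def normW11 (Ω : Opens (EuclideanSpace ℝ (Fin d)))
    (u : EuclideanSpace ℝ (Fin d) → EuclideanSpace ℝ ι) : ℝ≥0∞ :=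
  normL1 Ω u + normL1 Ω (weakGradient Ω u)

/-- `u ∈ BV²(Ω)`: `u ∈ W^{1,1}(Ω)` and `∇u ∈ BV(Ω)`. -/
def MemBV2 (Ω : Opens (EuclideanSpace ℝ (Fin d)))
    (u : EuclideanSpace ℝ (Fin d) → EuclideanSpace ℝ ι) : Prop :=
  MemW11 Ω u ∧ MemBV Ω (weakGradient Ω u)

theorem MemW11.isWeakGradient {Ω : Opens (EuclideanSpace ℝ (Fin d))}
    {u : EuclideanSpace ℝ (Fin d) → EuclideanSpace ℝ ι} (h : MemW11 Ω u) :
    IsWeakGradient Ω u (weakGradient Ω u) := by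
  rw [weakGradient, dif_pos h.2]
  exact h.2.choose_spec

theorem IsWeakGradient.ae_eq {Ω : Opens (EuclideanSpace ℝ (Fin d))}
    {u : EuclideanSpace ℝ (Fin d) → EuclideanSpace ℝ ι}
    {g g' : EuclideanSpace ℝ (Fin d) → EuclideanSpace ℝ (Fin d × ι)}
    (h : IsWeakGradient Ω u g) (h' : IsWeakGradient Ω u g') :
    g =ᵐ[volume.restrict (Ω : Set (EuclideanSpace ℝ (Fin d)))] g' := by
  have hi : IntegrableOn g Ω := memLp_one_iff_integrable.1 h.1
  have hi' : IntegrableOn g' Ω := memLp_one_iff_integrable.1 h'.1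
  have key : ∀ᵐ x, x ∈ (Ω : Set (EuclideanSpace ℝ (Fin d))) → (g - g') x = 0 := by
    refine Ω.isOpen.ae_eq_zero_of_integral_contDiff_smul_eq_zero
      (hi.sub hi').locallyIntegrableOn fun η hη hc hs => ?_
    obtain ⟨M, hM⟩ := hc.exists_bound_of_continuous hη.continuous
    have hint : ∀ f : EuclideanSpace ℝ (Fin d) → EuclideanSpace ℝ (Fin d × ι), IntegrableOn f Ω →
        IntegrableOn (fun x => η x • f x) Ω := fun f hf =>
      hf.bdd_smul M hη.continuous.aestronglyMeasurable (Filter.Eventually.of_forall hM)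
    have hset : ∫ x, η x • (g - g') x =
        ∫ x in (Ω : Set (EuclideanSpace ℝ (Fin d))), η x • (g - g') x := by
      refine (setIntegral_eq_integral_of_forall_compl_eq_zero fun x hx => ?_).symm
      rw [image_eq_zero_of_notMem_tsupport (fun hx' => hx (hs hx')), zero_smul]
    refine hset.trans (ext_inner_right ℝ fun v => ?_)
    rw [inner_zero_left, real_inner_comm, ← integral_inner (hint _ (hi.sub hi'))]
    let ψ : 𝓓^{1}(Ω, EuclideanSpace ℝ (Fin d × ι)) :=
      ⟨fun x => η x • v, (hη.of_le (by exact_mod_cast le_top)).smul contDiff_const, hc.smul_right,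
        (tsupport_smul_subset_left η _).trans hs⟩
    have e : ∫ x in (Ω : Set (EuclideanSpace ℝ (Fin d))), inner ℝ (g x) (ψ x) =
        ∫ x in (Ω : Set (EuclideanSpace ℝ (Fin d))), inner ℝ (g' x) (ψ x) :=
      neg_injective ((h.2 ψ).symm.trans (h'.2 ψ))
    have t : ∀ f : EuclideanSpace ℝ (Fin d) → EuclideanSpace ℝ (Fin d × ι),
        ∀ x, inner ℝ (f x) (ψ x) = inner ℝ v (η x • f x) := fun f x => by
      change inner ℝ (f x) (η x • v) = _
      rw [inner_smul_right, inner_smul_right, real_inner_comm]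
    simp only [t] at e
    simp only [Pi.sub_apply, smul_sub, inner_sub_right]
    rw [integral_sub ((hint g hi).const_inner v) ((hint g' hi').const_inner v), e, sub_self]
  rw [Filter.EventuallyEq, ae_restrict_iff' Ω.isOpen.measurableSet]
  filter_upwards [key] with x hx hxΩ
  exact sub_eq_zero.1 (hx hxΩ)

end BVPlane

end

/-! By the triangle inequality for `∇φ = (∇φ - w) + w`, it suffices to bound `‖w‖₁` by the
right-hand side. This can be done locally, by duality: on an open piece `V ∩ Ω`, the norm `‖w‖₁` is
controlled by the pairings of `w` with test fields `ψ` of norm at most one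
(`eLpNorm_one_le_of_forall_testFunction`).

Let `ρ` be a mollifier, possibly centred away from the origin, and split `ψ = div Ψ + η` with `η = ρ
⋆ ψ`. The field `Ψ` records the transport of `ψ` along the segments from `x` to `x + z` with `z` in
the support of `ρ` (`divergence_transportField`). If these segments stay in `Ω`, both `Ψ` and `η`
are admissible on `Ω`. Then `∫ ⟨w, div Ψ⟩` is at most `R * TV(w)`, since `|Ψ| ≤ R`. Also `∫ ⟨w, η⟩ =
-∫ ⟨φ, div η⟩ - ∫ ⟨∇φ - w, η⟩`, where `|div η|` is bounded in terms of `ρ` alone. This is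
`IsMollifier.hasBoundOn`.

The segments stay in `Ω` near an interior point if `ρ` lives on a small ball about the origin, and
near a boundary point if it lives on a small ball inside the cone pointing above the Lipschitz
graph. Compactness of the closure of `Ω` leaves finitely many pieces. The argument is direct: it
needs neither an extension operator nor a compact embedding. -/

noncomputable section

namespace BVPlane

open Set Metric
open scoped Manifold ContDiff Convolution Pointwise

/-! ### Duality for the `L¹` norm -/

/-- A smooth cutoff function between a compact set and an open set containing it. -/
theorem exists_contDiff_cutoff {E : Type*} [NormedAddCommGroup E] [InnerProductSpace ℝ E]
    [FiniteDimensional ℝ E] {K U : Set E} (hK : IsCompact K) (hU : IsOpen U)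
    (hKU : K ⊆ U) :
    ∃ χ : E → ℝ, ContDiff ℝ ∞ χ ∧ HasCompactSupport χ ∧ tsupport χ ⊆ U ∧ (∀ x, 0 ≤ χ x) ∧
      (∀ x, χ x ≤ 1) ∧ ∀ x ∈ K, χ x = 1 := by
  obtain ⟨δ, hδ, hδU⟩ := hK.exists_cthickening_subset_open hU hKU
  obtain ⟨χ, hχ, hr, hs, h1⟩ := exists_contMDiff_support_eq_eq_one_iff (n := (⊤ : ℕ∞)) 𝓘(ℝ, E)
    (isOpen_thickening (δ := δ) (E := K)) hK.isClosed (self_subset_thickening hδ K)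
  have hts : tsupport χ ⊆ cthickening δ K := by
    rw [tsupport, hs]
    exact closure_thickening_subset_cthickening _ _
  refine ⟨χ, hχ.contDiff, ?_, hts.trans hδU, fun x => (hr ⟨x, rfl⟩).1, fun x => (hr ⟨x, rfl⟩).2,
    fun x hx => (h1 x).1 hx⟩
  exact hK.cthickening.of_isClosed_subset (isClosed_tsupport _) hts

/-- Pairing a vector of length `a` with its smoothed direction loses at most `δ` of its length. -/
theorem sub_le_sq_div_sqrt {a δ : ℝ} (ha : 0 ≤ a) (hδ : 0 < δ) :
    a - δ ≤ a ^ 2 / √(a ^ 2 + δ ^ 2) := by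
  have hpos : 0 < √(a ^ 2 + δ ^ 2) := Real.sqrt_pos.2 (by positivity)
  have hle : √(a ^ 2 + δ ^ 2) ≤ a + δ :=
    Real.sqrt_le_iff.2 ⟨by positivity, by nlinarith [mul_nonneg ha hδ.le]⟩
  rw [le_div_iff₀ hpos]
  rcases le_total a δ with h | h
  · nlinarith [mul_nonneg (sub_nonneg.2 h) hpos.le, sq_nonneg a]
  · nlinarith [mul_le_mul_of_nonneg_left hle (sub_nonneg.2 h), sq_nonneg δ]

section Duality

variable {E F : Type*} [NormedAddCommGroup E] [InnerProductSpace ℝ E] [FiniteDimensional ℝ E]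
  [MeasurableSpace E] [BorelSpace E] [NormedAddCommGroup F] [InnerProductSpace ℝ F]

theorem norm_div_sqrt_smul_le_one (v : F) {δ : ℝ} (hδ : 0 < δ) :
    ‖(√(‖v‖ ^ 2 + δ ^ 2))⁻¹ • v‖ ≤ 1 := by
  have hpos : 0 < √(‖v‖ ^ 2 + δ ^ 2) := Real.sqrt_pos.2 (by positivity)
  rw [norm_smul, norm_inv, Real.norm_of_nonneg hpos.le, inv_mul_le_iff₀ hpos, mul_one]
  exact Real.le_sqrt_of_sq_le (by nlinarith [sq_nonneg δ])

/-- The ideal test field is `f / |f|`. It is made admissible by approximating `f` in `L¹` by a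
smooth `g`, replacing `|g|` by `√(|g|² + δ²)`, and cutting off outside `K`. -/
theorem setIntegral_norm_le_of_forall_testFunction {μ : Measure E} [IsFiniteMeasureOnCompacts μ]
    {U : Opens E} {f : E → F} (hf : IntegrableOn f U μ) {M : ℝ}
    (h : ∀ ψ : 𝓓^{1}(U, F), (∀ x, ‖ψ x‖ ≤ 1) →
      ∫ x in (U : Set E), inner ℝ (f x) (ψ x) ∂μ ≤ M)
    {K : Set E} (hK : IsCompact K) (hKU : K ⊆ U) :
    ∫ x in K, ‖f x‖ ∂μ ≤ M := by
  obtain ⟨χ, hχ, hχc, hχU, hχ0, hχ1, hχK⟩ := exists_contDiff_cutoff hK U.isOpen hKU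
  set ν := μ.restrict (U : Set E)
  have hχi : Integrable χ ν :=
    (hχ.continuous.integrable_of_hasCompactSupport hχc).restrict
  refine le_of_forall_pos_le_add fun ε hε => ?_
  set I := ∫ x, χ x ∂ν
  have hI0 : 0 ≤ I := integral_nonneg hχ0
  obtain ⟨g, -, hg, hfg⟩ := (memLp_one_iff_integrable.2 hf).exist_eLpNorm_sub_le
    ENNReal.one_ne_top le_rfl (by positivity : 0 < ε / 4)
  -- The error budget is `I * δ ≤ ε / 2` for the smoothing and `2 * (ε / 4)` for the approximation;
  -- the `1` keeps the denominator positive.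
  set δ := ε / (2 * (I + 1)) with hδ_def
  have hδ : 0 < δ := by positivity
  have hδI : I * δ ≤ ε / 2 := by
    rw [hδ_def, mul_div_assoc', div_le_div_iff₀ (by positivity) (by positivity)]
    nlinarith
  have hs : ∀ x, 0 < ‖g x‖ ^ 2 + δ ^ 2 := fun x => by positivity
  set n : E → F := fun x => (√(‖g x‖ ^ 2 + δ ^ 2))⁻¹ • g x with hn
  have hnc : ContDiff ℝ ∞ n :=
    (((hg.norm_sq ℝ).add contDiff_const).sqrt fun x => (hs x).ne').inv
      (fun x => (Real.sqrt_pos.2 (hs x)).ne') |>.smul hg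
  have hn1 : ∀ x, ‖n x‖ ≤ 1 := fun x => norm_div_sqrt_smul_le_one _ hδ
  let ψ : 𝓓^{1}(U, F) :=
    ⟨fun x => χ x • n x, (hχ.smul hnc).of_le (by exact_mod_cast le_top), hχc.smul_right,
      (tsupport_smul_subset_left χ _).trans hχU⟩
  have hψ : ∀ x, ψ x = χ x • n x := fun _ => rfl
  have hψ1 : ∀ x, ‖ψ x‖ ≤ 1 := fun x => by
    rw [hψ, norm_smul, Real.norm_of_nonneg (hχ0 x)]
    exact mul_le_one₀ (hχ1 x) (norm_nonneg _) (hn1 x)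
  have hfgi : Integrable (f - g) ν := by
    refine ⟨hf.1.sub hg.continuous.aestronglyMeasurable, ?_⟩
    rw [hasFiniteIntegral_iff_enorm, ← eLpNorm_one_eq_lintegral_enorm]
    exact hfg.trans_lt ENNReal.ofReal_lt_top
  have hfgε : ∫ x, ‖(f - g) x‖ ∂ν ≤ ε / 4 := by
    rw [eLpNorm_one_eq_lintegral_enorm] at hfg
    rw [integral_norm_eq_lintegral_enorm hfgi.1]
    exact ENNReal.toReal_le_of_le_ofReal (by positivity) hfg
  have hχf : Integrable (fun x => χ x * ‖f x‖) ν :=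
    hf.norm.bdd_mul (c := 1) hχ.continuous.aestronglyMeasurable
      (.of_forall fun x => by rw [Real.norm_of_nonneg (hχ0 x)]; exact hχ1 x)
  -- The difference `f - g` is paid for twice: once in the pairing with `ψ` and once in passing from
  -- `‖g‖` back to `‖f‖`.
  have hpt : ∀ x, χ x * ‖f x‖ - χ x * δ - 2 * ‖(f - g) x‖ ≤ inner ℝ (f x) (ψ x) := fun x => by
    have e : inner ℝ (f x) (ψ x)
        = χ x * (‖g x‖ ^ 2 / √(‖g x‖ ^ 2 + δ ^ 2)) + inner ℝ ((f - g) x) (ψ x) := by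
      simp only [Pi.sub_apply, inner_sub_left, hψ, hn, inner_smul_right, real_inner_self_eq_norm_sq]
      ring
    have h1 : |inner ℝ ((f - g) x) (ψ x)| ≤ ‖(f - g) x‖ :=
      (abs_real_inner_le_norm _ _).trans (mul_le_of_le_one_right (norm_nonneg _) (hψ1 x))
    have h2 := mul_le_mul_of_nonneg_left (sub_le_sq_div_sqrt (norm_nonneg (g x)) hδ) (hχ0 x)
    have h3 : ‖f x‖ ≤ ‖(f - g) x‖ + ‖g x‖ := by
      simpa using norm_add_le ((f - g) x) (g x)
    have h4 := mul_le_mul_of_nonneg_left h3 (hχ0 x)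
    have h5 := mul_le_of_le_one_left (norm_nonneg ((f - g) x)) (hχ1 x)
    have h6 := neg_abs_le (inner ℝ ((f - g) x) (ψ x))
    rw [e]
    linarith
  have hinner : Integrable (fun x => inner ℝ (f x) (ψ x)) ν := by
    refine hf.norm.mono (hf.1.inner ψ.continuous.aestronglyMeasurable) (.of_forall fun x => ?_)
    rw [norm_norm]
    exact (norm_inner_le_norm _ _).trans (mul_le_of_le_one_right (norm_nonneg _) (hψ1 x))
  have hint := integral_mono ((hχf.sub (hχi.mul_const δ)).sub (hfgi.norm.const_mul 2)) hinner hpt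
  have hsplit : ∫ x, (χ x * ‖f x‖ - χ x * δ - 2 * ‖(f - g) x‖) ∂ν
      = ∫ x, χ x * ‖f x‖ ∂ν - I * δ - 2 * ∫ x, ‖(f - g) x‖ ∂ν := by
    have hsub : Integrable (fun x => χ x * ‖f x‖ - χ x * δ) ν := hχf.sub (hχi.mul_const δ)
    rw [integral_sub hsub (hfgi.norm.const_mul 2),
      integral_sub hχf (hχi.mul_const δ), integral_mul_const, integral_const_mul]
  have hKle : ∫ x in K, ‖f x‖ ∂μ ≤ ∫ x, χ x * ‖f x‖ ∂ν := by
    have e : ∫ x in K, ‖f x‖ ∂μ = ∫ x in K, χ x * ‖f x‖ ∂μ :=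
      setIntegral_congr_fun hK.measurableSet fun x hx => by simp only [hχK x hx, one_mul]
    rw [e]
    exact setIntegral_mono_set hχf (.of_forall fun x => mul_nonneg (hχ0 x) (norm_nonneg _))
      (LE.le.eventuallyLE hKU)
  have hM := h ψ hψ1
  have hint' : ∫ x, (χ x * ‖f x‖ - χ x * δ - 2 * ‖(f - g) x‖) ∂ν ≤ ∫ x, inner ℝ (f x) (ψ x) ∂ν :=
    hint
  rw [hsplit] at hint'
  linarith

/-- The `L¹` norm of a field is controlled by its pairings with test fields of norm at most one. -/
theorem eLpNorm_one_le_of_forall_testFunction {μ : Measure E} [IsFiniteMeasureOnCompacts μ]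
    {U : Opens E} {f : E → F} (hf : IntegrableOn f U μ) {M : ℝ}
    (h : ∀ ψ : 𝓓^{1}(U, F), (∀ x, ‖ψ x‖ ≤ 1) →
      ∫ x in (U : Set E), inner ℝ (f x) (ψ x) ∂μ ≤ M) :
    eLpNorm f 1 (μ.restrict (U : Set E)) ≤ ENNReal.ofReal M := by
  -- Inner regularity of the finite measure with density `‖f‖` carries the bound from compact
  -- subsets to `U`.
  have hfin : IsFiniteMeasure ((μ.restrict (U : Set E)).withDensity fun x => ‖f x‖ₑ) :=
    isFiniteMeasure_withDensity hf.2.ne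
  have hUeq : ((μ.restrict (U : Set E)).withDensity fun x => ‖f x‖ₑ) U
      = eLpNorm f 1 (μ.restrict (U : Set E)) := by
    rw [withDensity_apply _ U.isOpen.measurableSet, Measure.restrict_restrict_of_subset le_rfl,
      eLpNorm_one_eq_lintegral_enorm]
  rw [← hUeq, U.isOpen.measure_eq_iSup_isCompact]
  refine iSup₂_le fun K hKU => iSup_le fun hK => ?_
  have hfK : IntegrableOn f K μ := hf.mono_set hKU
  rw [withDensity_apply _ hK.measurableSet, Measure.restrict_restrict_of_subset hKU,
    ← ofReal_integral_norm_eq_lintegral_enorm hfK]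
  exact ENNReal.ofReal_le_ofReal (setIntegral_norm_le_of_forall_testFunction hf h hK hKU)

end Duality

/-! ### Differentiation of averages of translates -/

section ParametricIntegral

variable {P E F G : Type*} [TopologicalSpace P] [MeasurableSpace P] [OpensMeasurableSpace P]
  [SecondCountableTopology P] {μ : Measure P} [IsFiniteMeasure μ]
  [NormedAddCommGroup E] [NormedAddCommGroup F] [NormedSpace ℝ F]
  [NormedAddCommGroup G] [NormedSpace ℝ G]
  {L : P → F →L[ℝ] G} {X : P → E} {ψ : E → F} {B : ℝ}

theorem integrable_clm_apply_comp_sub (hL : Continuous L) (hB : ∀ p, ‖L p‖ ≤ B)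
    (hX : Continuous X) (hψ : Continuous ψ) (hc : HasCompactSupport ψ) (y : E) :
    Integrable (fun p => L p (ψ (y - X p))) μ := by
  obtain ⟨M, hM⟩ := hc.exists_bound_of_continuous hψ
  have hcont : Continuous fun p => L p (ψ (y - X p)) :=
    hL.clm_apply (hψ.comp (continuous_const.sub hX))
  exact Integrable.of_bound hcont.aestronglyMeasurable (B * M)
    (.of_forall fun p => (L p).le_of_opNorm_le_of_le (hB p) (hM _))

variable [NormedSpace ℝ E]

theorem integrable_clm_comp_fderiv_comp_sub (hL : Continuous L) (hB : ∀ p, ‖L p‖ ≤ B)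
    (hX : Continuous X) (hψ : ContDiff ℝ 1 ψ) (hc : HasCompactSupport ψ) (y : E) :
    Integrable (fun p => (L p).comp (fderiv ℝ ψ (y - X p))) μ := by
  obtain ⟨M, hM⟩ := (hc.fderiv ℝ).exists_bound_of_continuous (hψ.continuous_fderiv one_ne_zero)
  have hcont : Continuous fun p => (L p).comp (fderiv ℝ ψ (y - X p)) :=
    hL.clm_comp ((hψ.continuous_fderiv one_ne_zero).comp (continuous_const.sub hX))
  refine Integrable.of_bound hcont.aestronglyMeasurable (B * M) (.of_forall fun p => ?_)
  exact ((L p).opNorm_comp_le _).trans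
    (mul_le_mul (hB p) (hM _) (norm_nonneg _) ((norm_nonneg _).trans (hB p)))

theorem hasFDerivAt_integral_clm_apply_comp_sub (hL : Continuous L) (hB : ∀ p, ‖L p‖ ≤ B)
    (hX : Continuous X) (hψ : ContDiff ℝ 1 ψ) (hc : HasCompactSupport ψ) (y : E) :
    HasFDerivAt (fun y => ∫ p, L p (ψ (y - X p)) ∂μ)
      (∫ p, (L p).comp (fderiv ℝ ψ (y - X p)) ∂μ) y := by
  obtain ⟨M, hM⟩ := (hc.fderiv ℝ).exists_bound_of_continuous (hψ.continuous_fderiv one_ne_zero)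
  refine hasFDerivAt_integral_of_dominated_of_fderiv_le (s := univ) (bound := fun _ => B * M)
    Filter.univ_mem
    (.of_forall fun y => (integrable_clm_apply_comp_sub hL hB hX hψ.continuous hc y).1)
    (integrable_clm_apply_comp_sub hL hB hX hψ.continuous hc y)
    (F' := fun y p => (L p).comp (fderiv ℝ ψ (y - X p)))
    (integrable_clm_comp_fderiv_comp_sub hL hB hX hψ hc y).1
    (.of_forall fun p y _ => ?_) (integrable_const _) (.of_forall fun p y _ => ?_)
  · exact ((L p).opNorm_comp_le _).trans
      (mul_le_mul (hB p) (hM _) (norm_nonneg _) ((norm_nonneg _).trans (hB p)))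
  · exact (L p).hasFDerivAt.comp y
      ((hasFDerivAt_comp_sub (X p)).2 ((hψ.differentiable one_ne_zero) (y - X p)).hasFDerivAt)

theorem contDiff_integral_clm_apply_comp_sub (hL : Continuous L) (hB : ∀ p, ‖L p‖ ≤ B)
    (hX : Continuous X) (hψ : ContDiff ℝ 1 ψ) (hc : HasCompactSupport ψ) :
    ContDiff ℝ 1 (fun y => ∫ p, L p (ψ (y - X p)) ∂μ) := by
  obtain ⟨M, hM⟩ := (hc.fderiv ℝ).exists_bound_of_continuous (hψ.continuous_fderiv one_ne_zero)
  refine contDiff_one_iff_hasFDerivAt.2 ⟨_, ?_, fun y =>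
    hasFDerivAt_integral_clm_apply_comp_sub hL hB hX hψ hc y⟩
  refine continuous_of_dominated (bound := fun _ => B * M)
    (fun y => (integrable_clm_comp_fderiv_comp_sub hL hB hX hψ hc y).1)
    (fun y => .of_forall fun p => ?_) (integrable_const _) (.of_forall fun p => ?_)
  · exact ((L p).opNorm_comp_le _).trans
      (mul_le_mul (hB p) (hM _) (norm_nonneg _) ((norm_nonneg _).trans (hB p)))
  · exact continuous_const.clm_comp
      ((hψ.continuous_fderiv one_ne_zero).comp (continuous_id.sub continuous_const))

end ParametricIntegral

/-! ### Algebra of the divergence -/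

section Divergence

variable {d : ℕ} {ι : Type} [Fintype ι]

theorem norm_toLp_mul (z : EuclideanSpace ℝ (Fin d)) (u : EuclideanSpace ℝ ι) :
    ‖(WithLp.toLp 2 fun p : Fin d × ι => z p.1 * u p.2 : EuclideanSpace ℝ (Fin d × ι))‖
      = ‖z‖ * ‖u‖ := by
  rw [EuclideanSpace.norm_eq, EuclideanSpace.norm_eq, EuclideanSpace.norm_eq,
    ← Real.sqrt_mul (Finset.sum_nonneg fun _ _ => sq_nonneg _), Finset.sum_mul_sum,
    Fintype.sum_prod_type]
  simp only [norm_mul, mul_pow]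

/-- The tensor product of a vector and a tensor, `(z ⊗ u)_{j,i} = z_j u_i`. -/
def tensor : EuclideanSpace ℝ (Fin d) →L[ℝ] EuclideanSpace ℝ ι →L[ℝ]
    EuclideanSpace ℝ (Fin d × ι) :=
  LinearMap.mkContinuous₂
    (LinearMap.mk₂ ℝ (fun z u => WithLp.toLp 2 fun p => z p.1 * u p.2)
      (fun _ _ _ => by ext; simp [add_mul]) (fun _ _ _ => by ext; simp [mul_assoc])
      (fun _ _ _ => by ext; simp [mul_add]) (fun _ _ _ => by ext; simp [mul_left_comm]))
    1 fun z u => by simpa using (norm_toLp_mul z u).le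

@[simp]
theorem tensor_apply (z : EuclideanSpace ℝ (Fin d)) (u : EuclideanSpace ℝ ι) (j : Fin d) (i : ι) :
    tensor z u (j, i) = z j * u i := rfl

theorem norm_tensor (z : EuclideanSpace ℝ (Fin d)) (u : EuclideanSpace ℝ ι) :
    ‖tensor z u‖ = ‖z‖ * ‖u‖ := norm_toLp_mul z u

variable (d ι) in
/-- The divergence as a function of the derivative. -/
def divergenceCLM : (EuclideanSpace ℝ (Fin d) →L[ℝ] EuclideanSpace ℝ (Fin d × ι)) →L[ℝ]
    EuclideanSpace ℝ ι :=
  LinearMap.toContinuousLinearMap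
    { toFun := fun A => WithLp.toLp 2 fun i => ∑ j, A (EuclideanSpace.single j 1) (j, i)
      map_add' := fun A A' => by ext; simp [Finset.sum_add_distrib]
      map_smul' := fun c A => by ext; simp [Finset.mul_sum] }

theorem divergenceCLM_apply
    (A : EuclideanSpace ℝ (Fin d) →L[ℝ] EuclideanSpace ℝ (Fin d × ι)) (i : ι) :
    divergenceCLM d ι A i = ∑ j, A (EuclideanSpace.single j 1) (j, i) := rfl

theorem divergence_eq_divergenceCLM (ψ : EuclideanSpace ℝ (Fin d) → EuclideanSpace ℝ (Fin d × ι))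
    (x : EuclideanSpace ℝ (Fin d)) : divergence ψ x = divergenceCLM d ι (fderiv ℝ ψ x) := rfl

/-- Tensoring with a constant `z` turns the divergence into the directional derivative along `z`,
which can then be integrated along a segment. -/
theorem divergenceCLM_tensor_comp (z : EuclideanSpace ℝ (Fin d))
    (A : EuclideanSpace ℝ (Fin d) →L[ℝ] EuclideanSpace ℝ ι) :
    divergenceCLM d ι ((tensor z).comp A) = A z := by
  have hz : z = ∑ j, z j • EuclideanSpace.single j (1 : ℝ) := by
    ext k
    simp [Finset.sum_apply, Pi.single_apply]
  ext i
  conv_rhs => rw [hz, map_sum]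
  simp [divergenceCLM_apply]

theorem divergence_const_smul {c : ℝ}
    {ψ : EuclideanSpace ℝ (Fin d) → EuclideanSpace ℝ (Fin d × ι)}
    (x : EuclideanSpace ℝ (Fin d)) :
    divergence (fun y => c • ψ y) x = c • divergence ψ x := by
  rw [divergence_eq_divergenceCLM, divergence_eq_divergenceCLM, ← map_smul]
  exact congrArg (fun A => divergenceCLM d ι (A x)) (fderiv_const_smul_field c)

theorem continuous_divergence {ψ : EuclideanSpace ℝ (Fin d) → EuclideanSpace ℝ (Fin d × ι)}
    (hψ : ContDiff ℝ 1 ψ) : Continuous (divergence ψ) :=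
  (divergenceCLM d ι).continuous.comp (hψ.continuous_fderiv one_ne_zero)

end Divergence

/-! ### Transport of a field to its mollification -/

section Transport

variable {d : ℕ} {ι : Type} [Fintype ι]

/-- A mollifier supported in the closed ball of radius `R` about the origin (not necessarily
centred there). -/
structure IsMollifier (ρ : EuclideanSpace ℝ (Fin d) → ℝ) (R : ℝ) : Prop where
  contDiff : ContDiff ℝ 1 ρ
  hasCompactSupport : HasCompactSupport ρ
  nonneg : ∀ z, 0 ≤ ρ z
  integral_eq_one : ∫ z, ρ z = 1
  tsupport_subset : tsupport ρ ⊆ closedBall 0 R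

/-- The parameter space of the segments `y - t z` with `0 < t ≤ 1` and `|z| ≤ R`. -/
abbrev segmentMeasure (d : ℕ) (R : ℝ) : Measure (ℝ × EuclideanSpace ℝ (Fin d)) :=
  ((volume : Measure ℝ).restrict (Ioc 0 1)).prod
    ((volume : Measure (EuclideanSpace ℝ (Fin d))).restrict (closedBall 0 R))

instance isFiniteMeasure_restrict_closedBall (R : ℝ) : IsFiniteMeasure
    ((volume : Measure (EuclideanSpace ℝ (Fin d))).restrict (closedBall 0 R)) :=
  ⟨by rw [Measure.restrict_apply_univ]; exact measure_closedBall_lt_top⟩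

variable {ρ : EuclideanSpace ℝ (Fin d) → ℝ} {R : ℝ}

/-- The kernel `ρ(z) z ⊗ ·`. -/
def segmentKernel (ι : Type) [Fintype ι] (ρ : EuclideanSpace ℝ (Fin d) → ℝ)
    (p : ℝ × EuclideanSpace ℝ (Fin d)) :
    EuclideanSpace ℝ ι →L[ℝ] EuclideanSpace ℝ (Fin d × ι) := ρ p.2 • tensor p.2

/-- The field `Ψ(y) = ∫ ρ(z) ∫₀¹ z ⊗ ψ(y - t z) dt dz`. -/
def transportField (ρ : EuclideanSpace ℝ (Fin d) → ℝ) (R : ℝ)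
    (ψ : EuclideanSpace ℝ (Fin d) → EuclideanSpace ℝ ι) (y : EuclideanSpace ℝ (Fin d)) :
    EuclideanSpace ℝ (Fin d × ι) :=
  ∫ p, segmentKernel ι ρ p (ψ (y - p.1 • p.2)) ∂(segmentMeasure d R)

namespace IsMollifier

theorem eq_zero_of_notMem (hρ : IsMollifier ρ R) {z : EuclideanSpace ℝ (Fin d)}
    (hz : z ∉ closedBall 0 R) : ρ z = 0 :=
  image_eq_zero_of_notMem_tsupport fun h => hz (hρ.tsupport_subset h)

theorem setIntegral_eq_one (hρ : IsMollifier ρ R) : ∫ z in closedBall 0 R, ρ z = 1 := by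
  rw [setIntegral_eq_integral_of_forall_compl_eq_zero fun z hz => hρ.eq_zero_of_notMem hz,
    hρ.integral_eq_one]

theorem integrable (hρ : IsMollifier ρ R) : Integrable ρ :=
  hρ.contDiff.continuous.integrable_of_hasCompactSupport hρ.hasCompactSupport

theorem mul_norm_le (hρ : IsMollifier ρ R) (z : EuclideanSpace ℝ (Fin d)) :
    ρ z * ‖z‖ ≤ ρ z * R := by
  by_cases hz : z ∈ closedBall (0 : EuclideanSpace ℝ (Fin d)) R
  · exact mul_le_mul_of_nonneg_left (mem_closedBall_zero_iff.1 hz) (hρ.nonneg z)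
  · simp [hρ.eq_zero_of_notMem hz]

theorem continuous_segmentKernel (hρ : IsMollifier ρ R) : Continuous (segmentKernel ι ρ) :=
  (hρ.contDiff.continuous.comp continuous_snd).smul (tensor.continuous.comp continuous_snd)

theorem exists_norm_segmentKernel_le (hρ : IsMollifier ρ R) :
    ∃ B, ∀ p, ‖segmentKernel ι ρ p‖ ≤ B := by
  obtain ⟨B, hB⟩ := (hρ.hasCompactSupport.smul_right
    (f' := fun z => (tensor z : EuclideanSpace ℝ ι →L[ℝ] _))).exists_bound_of_continuous
    (hρ.contDiff.continuous.smul tensor.continuous)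
  exact ⟨B, fun p => hB p.2⟩

/-- `ρ` is a probability density living on `|z| ≤ R`, and `|z ⊗ ψ| = |z| |ψ| ≤ R` there. -/
theorem norm_transportField_le (hρ : IsMollifier ρ R)
    {ψ : EuclideanSpace ℝ (Fin d) → EuclideanSpace ℝ ι} (hψ1 : ∀ x, ‖ψ x‖ ≤ 1)
    (y : EuclideanSpace ℝ (Fin d)) : ‖transportField ρ R ψ y‖ ≤ R := by
  have hi : Integrable (fun p => ρ p.2 * R) (segmentMeasure d R) :=
    (Integrable.comp_snd hρ.integrable.restrict _).mul_const R
  refine (norm_integral_le_of_norm_le hi (.of_forall fun p => ?_)).trans_eq ?_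
  · have h := mul_le_of_le_one_right (mul_nonneg (hρ.nonneg p.2) (norm_nonneg p.2))
      (hψ1 (y - p.1 • p.2))
    simp only [segmentKernel, _root_.smul_apply, norm_smul, norm_tensor,
      Real.norm_of_nonneg (hρ.nonneg p.2)]
    rw [← mul_assoc]
    exact h.trans (hρ.mul_norm_le p.2)
  · rw [integral_mul_const, integral_fun_snd (fun z => ρ z), hρ.setIntegral_eq_one]
    simp [Measure.real]

theorem contDiff_transportField (hρ : IsMollifier ρ R)
    {ψ : EuclideanSpace ℝ (Fin d) → EuclideanSpace ℝ ι} (hψ : ContDiff ℝ 1 ψ)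
    (hc : HasCompactSupport ψ) : ContDiff ℝ 1 (transportField ρ R ψ) := by
  obtain ⟨B, hB⟩ := hρ.exists_norm_segmentKernel_le (ι := ι)
  exact contDiff_integral_clm_apply_comp_sub hρ.continuous_segmentKernel hB
    (continuous_fst.smul continuous_snd) hψ hc

theorem integral_fderiv_segment {F : Type*} [NormedAddCommGroup F] [NormedSpace ℝ F]
    [CompleteSpace F] {E : Type*} [NormedAddCommGroup E] [NormedSpace ℝ E]
    {ψ : E → F} (hψ : ContDiff ℝ 1 ψ) (y z : E) :
    ∫ t in Ioc (0 : ℝ) 1, fderiv ℝ ψ (y - t • z) z = ψ y - ψ (y - z) := by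
  rw [← intervalIntegral.integral_of_le zero_le_one]
  have hd : ∀ t : ℝ, HasDerivAt (fun t : ℝ => -ψ (y - t • z)) (fderiv ℝ ψ (y - t • z) z) t := by
    intro t
    have h1 : HasDerivAt (fun t : ℝ => y - t • z) (-z) t := by
      simpa using ((hasDerivAt_id t).smul_const z).const_sub y
    have h2 : HasDerivAt (fun t : ℝ => -ψ (y - t • z)) (-fderiv ℝ ψ (y - t • z) (-z)) t :=
      ((hψ.differentiable one_ne_zero (y - t • z)).hasFDerivAt.comp_hasDerivAt t h1).neg
    rwa [map_neg, neg_neg] at h2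
  have hc : Continuous fun t : ℝ => fderiv ℝ ψ (y - t • z) z :=
    ((hψ.continuous_fderiv one_ne_zero).comp
      (continuous_const.sub (continuous_id.smul continuous_const))).clm_apply continuous_const
  rw [intervalIntegral.integral_eq_sub_of_hasDerivAt (fun t _ => hd t) (hc.intervalIntegrable _ _)]
  simp [neg_add_eq_sub]

/-- Under the integral, the divergence of `z ⊗ ψ(y - t z)` is the derivative of `ψ` along `z`. Its
integral over `t` is `ψ(y) - ψ(y - z)`, and averaging against `ρ` gives the claim. -/
theorem divergence_transportField (hρ : IsMollifier ρ R)
    {ψ : EuclideanSpace ℝ (Fin d) → EuclideanSpace ℝ ι} (hψ : ContDiff ℝ 1 ψ)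
    (hc : HasCompactSupport ψ) (y : EuclideanSpace ℝ (Fin d)) :
    divergence (transportField ρ R ψ) y = ψ y - ∫ z, ρ z • ψ (y - z) := by
  obtain ⟨B, hB⟩ := hρ.exists_norm_segmentKernel_le (ι := ι)
  have hX : Continuous fun p : ℝ × EuclideanSpace ℝ (Fin d) => p.1 • p.2 :=
    continuous_fst.smul continuous_snd
  have hint := integrable_clm_comp_fderiv_comp_sub (μ := segmentMeasure d R)
    hρ.continuous_segmentKernel hB hX hψ hc y
  have hf : fderiv ℝ (transportField ρ R ψ) y = _ :=
    (hasFDerivAt_integral_clm_apply_comp_sub (μ := segmentMeasure d R)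
      hρ.continuous_segmentKernel hB hX hψ hc y).fderiv
  have hpt : ∀ p : ℝ × EuclideanSpace ℝ (Fin d),
      divergenceCLM d ι ((segmentKernel ι ρ p).comp (fderiv ℝ ψ (y - p.1 • p.2)))
        = ρ p.2 • fderiv ℝ ψ (y - p.1 • p.2) p.2 := fun p => by
    rw [segmentKernel, ContinuousLinearMap.smul_comp, map_smul, divergenceCLM_tensor_comp]
  have hint' := (divergenceCLM d ι).integrable_comp hint
  simp only [hpt] at hint'
  rw [divergence_eq_divergenceCLM, hf, ← ContinuousLinearMap.integral_comp_comm _ hint]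
  simp only [hpt]
  rw [integral_prod_symm _ hint']
  simp only [integral_smul, integral_fderiv_segment hψ, smul_sub]
  have hi1 : Integrable (fun z => ρ z • ψ y) := hρ.integrable.smul_const _
  have hi2 : Integrable (fun z => ρ z • ψ (y - z)) :=
    (hρ.contDiff.continuous.smul
      (hψ.continuous.comp (continuous_const.sub continuous_id))).integrable_of_hasCompactSupport
      hρ.hasCompactSupport.smul_right
  rw [integral_sub hi1.restrict hi2.restrict, integral_smul_const, hρ.setIntegral_eq_one, one_smul,
    setIntegral_eq_integral_of_forall_compl_eq_zero fun z hz => by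
      rw [hρ.eq_zero_of_notMem hz, zero_smul]]

/-- A field on `U` differs from its mollification by the divergence of a bounded field on `Ω`,
provided that the segments along which mass is moved lie in `Ω`. -/
theorem exists_testFunction_divergence (hρ : IsMollifier ρ R)
    {U Ω : Opens (EuclideanSpace ℝ (Fin d))}
    (hseg : ∀ x ∈ U, ∀ z ∈ tsupport ρ, ∀ t ∈ Icc (0 : ℝ) 1, x + t • z ∈ Ω)
    (ψ : 𝓓^{1}(U, EuclideanSpace ℝ ι)) (hψ1 : ∀ x, ‖ψ x‖ ≤ 1) :
    ∃ Ψ : 𝓓^{1}(Ω, EuclideanSpace ℝ (Fin d × ι)), (∀ y, ‖Ψ y‖ ≤ R) ∧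
      ∀ y, divergence Ψ y = ψ y - ∫ z, ρ z • ψ (y - z) := by
  -- All the segments swept from the support of `ψ`: a compact subset of `Ω` outside which the
  -- integrand of `Ψ` vanishes.
  set k : Set (EuclideanSpace ℝ (Fin d)) :=
    (fun q : ℝ × EuclideanSpace ℝ (Fin d) × EuclideanSpace ℝ (Fin d) => q.2.2 + q.1 • q.2.1) ''
      (Icc 0 1 ×ˢ tsupport ρ ×ˢ tsupport ψ) with hk
  have hkc : IsCompact k :=
    (isCompact_Icc.prod (hρ.hasCompactSupport.isCompact.prod ψ.hasCompactSupport.isCompact)).image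
      (by fun_prop)
  have hkΩ : k ⊆ Ω := by
    rintro _ ⟨⟨t, z, x⟩, ⟨ht, hz, hx⟩, rfl⟩
    exact hseg x (ψ.tsupport_subset hx) z hz t ht
  have hz : ∀ y ∉ k, transportField ρ R ψ y = 0 := fun y hy => by
    rw [transportField, segmentMeasure, Measure.prod_restrict]
    refine setIntegral_eq_zero_of_forall_eq_zero fun p hp => ?_
    by_cases hpz : p.2 ∈ tsupport ρ
    · rw [image_eq_zero_of_notMem_tsupport (f := ψ), map_zero]
      exact fun hx => hy ⟨(p.1, p.2, y - p.1 • p.2), ⟨Ioc_subset_Icc_self hp.1, hpz, hx⟩,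
        sub_add_cancel _ _⟩
    · simp [segmentKernel, image_eq_zero_of_notMem_tsupport hpz]
  have hts : tsupport (transportField ρ R ψ) ⊆ k :=
    closure_minimal (fun y hy => by_contra fun hyk => hy (hz y hyk)) hkc.isClosed
  exact ⟨⟨transportField ρ R ψ, hρ.contDiff_transportField ψ.contDiff ψ.hasCompactSupport,
    hkc.of_isClosed_subset (isClosed_tsupport _) hts, hts.trans hkΩ⟩,
    hρ.norm_transportField_le hψ1,
    hρ.divergence_transportField ψ.contDiff ψ.hasCompactSupport⟩

/-- The mollification of a field on `U` is a field on `Ω` whose divergence is bounded in terms of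
the mollifier only. -/
theorem exists_testFunction_mollify (hρ : IsMollifier ρ R)
    {U Ω : Opens (EuclideanSpace ℝ (Fin d))}
    (hseg : ∀ x ∈ U, ∀ z ∈ tsupport ρ, x + z ∈ Ω)
    (ψ : 𝓓^{1}(U, EuclideanSpace ℝ (Fin d × ι))) (hψ1 : ∀ x, ‖ψ x‖ ≤ 1) :
    ∃ η : 𝓓^{1}(Ω, EuclideanSpace ℝ (Fin d × ι)), (∀ y, η y = ∫ z, ρ z • ψ (y - z)) ∧
      (∀ y, ‖η y‖ ≤ 1) ∧
      ∀ y, ‖divergence η y‖ ≤ ‖divergenceCLM d ι‖ * ∫ z, ‖fderiv ℝ ρ z‖ := by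
  set L := ContinuousLinearMap.lsmul ℝ ℝ (E := EuclideanSpace ℝ (Fin d × ι))
  set η := ρ ⋆[L] (ψ : EuclideanSpace ℝ (Fin d) → EuclideanSpace ℝ (Fin d × ι))
  have hηy : ∀ y, η y = ∫ z, ρ z • ψ (y - z) := fun y => rfl
  have hli : LocallyIntegrable ψ volume := ψ.continuous.locallyIntegrable
  have hts : tsupport η ⊆ tsupport ρ + tsupport ψ := by
    refine closure_minimal ((support_convolution_subset L).trans
      (add_subset_add (subset_tsupport _) (subset_tsupport _))) ?_
    exact (hρ.hasCompactSupport.isCompact.add ψ.hasCompactSupport.isCompact).isClosed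
  have hsub : tsupport ρ + tsupport ψ ⊆ Ω := by
    rintro _ ⟨z, hz, x, hx, rfl⟩
    have := hseg x (ψ.tsupport_subset hx) z hz
    rwa [add_comm] at this
  refine ⟨⟨η, hρ.hasCompactSupport.contDiff_convolution_left L (n := 1) hρ.contDiff hli,
    (hρ.hasCompactSupport.isCompact.add ψ.hasCompactSupport.isCompact).of_isClosed_subset
      (isClosed_tsupport _) hts, hts.trans hsub⟩, hηy, fun y => ?_, fun y => ?_⟩
  · change ‖η y‖ ≤ 1
    rw [hηy, ← hρ.integral_eq_one]
    refine norm_integral_le_of_norm_le hρ.integrable (.of_forall fun z => ?_)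
    rw [norm_smul, Real.norm_of_nonneg (hρ.nonneg z)]
    exact mul_le_of_le_one_right (hρ.nonneg z) (hψ1 _)
  · change ‖divergence η y‖ ≤ _
    rw [divergence_eq_divergenceCLM,
      (hρ.hasCompactSupport.hasFDerivAt_convolution_left L hρ.contDiff hli y).fderiv]
    refine (divergenceCLM d ι).le_opNorm_of_le ?_
    refine norm_integral_le_of_norm_le
      ((hρ.contDiff.continuous_fderiv one_ne_zero).norm.integrable_of_hasCompactSupport
        (hρ.hasCompactSupport.fderiv ℝ).norm) (.of_forall fun z => ?_)
    refine ContinuousLinearMap.opNorm_le_bound _ (norm_nonneg _) fun v => ?_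
    change ‖fderiv ℝ ρ z v • ψ (y - z)‖ ≤ _
    rw [norm_smul]
    exact (mul_le_of_le_one_right (norm_nonneg _) (hψ1 _)).trans ((fderiv ℝ ρ z).le_opNorm v)

end IsMollifier

end Transport

/-! ### Local estimate and compactness -/

section Estimate

variable {d : ℕ} {ι : Type} [Fintype ι]

theorem integrable_inner_of_continuous {κ : Type} [Fintype κ]
    {Ω : Opens (EuclideanSpace ℝ (Fin d))}
    {u : EuclideanSpace ℝ (Fin d) → EuclideanSpace ℝ κ} (hu : MemL1 Ω u)
    {η : EuclideanSpace ℝ (Fin d) → EuclideanSpace ℝ κ} (hη : Continuous η) {B : ℝ}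
    (hB : ∀ x, ‖η x‖ ≤ B) :
    Integrable (fun x => inner ℝ (u x) (η x))
      (volume.restrict (Ω : Set (EuclideanSpace ℝ (Fin d)))) := by
  have hu' := memLp_one_iff_integrable.1 hu
  refine (hu'.norm.mul_const B).mono' (hu'.1.inner hη.aestronglyMeasurable)
    (.of_forall fun x => ?_)
  exact (norm_inner_le_norm _ _).trans (mul_le_mul_of_nonneg_left (hB x) (norm_nonneg _))

theorem integral_inner_le_mul_integral_norm {κ : Type} [Fintype κ]
    {Ω : Opens (EuclideanSpace ℝ (Fin d))}
    {u : EuclideanSpace ℝ (Fin d) → EuclideanSpace ℝ κ} (hu : MemL1 Ω u)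
    {η : EuclideanSpace ℝ (Fin d) → EuclideanSpace ℝ κ} {B : ℝ} (hB : ∀ x, ‖η x‖ ≤ B) :
    |∫ x in (Ω : Set (EuclideanSpace ℝ (Fin d))), inner ℝ (u x) (η x)|
      ≤ (normL1 Ω u).toReal * B := by
  have hu' := memLp_one_iff_integrable.1 hu
  have e : (normL1 Ω u).toReal = ∫ x in (Ω : Set (EuclideanSpace ℝ (Fin d))), ‖u x‖ := by
    rw [integral_norm_eq_lintegral_enorm hu'.1, normL1, eLpNorm_one_eq_lintegral_enorm]
  rw [e, ← integral_mul_const, ← Real.norm_eq_abs]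
  exact norm_integral_le_of_norm_le (hu'.norm.mul_const B) (.of_forall fun x =>
    (norm_inner_le_norm _ _).trans (mul_le_mul_of_nonneg_left (hB x) (norm_nonneg _)))

theorem exists_norm_divergence_le {Ω : Opens (EuclideanSpace ℝ (Fin d))}
    (ψ : 𝓓^{1}(Ω, EuclideanSpace ℝ (Fin d × ι))) : ∃ B, ∀ x, ‖divergence ψ x‖ ≤ B := by
  obtain ⟨B, hB⟩ := (ψ.hasCompactSupport.fderiv ℝ).exists_bound_of_continuous
    (ψ.contDiff.continuous_fderiv one_ne_zero)
  exact ⟨_, fun x => (divergenceCLM d ι).le_opNorm_of_le (hB x)⟩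

theorem integral_inner_divergence_le {Ω : Opens (EuclideanSpace ℝ (Fin d))}
    {u : EuclideanSpace ℝ (Fin d) → EuclideanSpace ℝ ι} (hu : TV Ω u < ⊤) {R : ℝ} (hR : 0 < R)
    (Ψ : 𝓓^{1}(Ω, EuclideanSpace ℝ (Fin d × ι))) (hΨ : ∀ x, ‖Ψ x‖ ≤ R) :
    ∫ x in (Ω : Set (EuclideanSpace ℝ (Fin d))), inner ℝ (u x) (divergence Ψ x)
      ≤ R * (TV Ω u).toReal := by
  have hn : ∀ x, ‖(R⁻¹ • Ψ) x‖ ≤ 1 := fun x => by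
    change ‖R⁻¹ • Ψ x‖ ≤ 1
    rw [norm_smul, norm_inv, Real.norm_of_nonneg hR.le, inv_mul_le_iff₀ hR, mul_one]
    exact hΨ x
  have hle := le_iSup₂ (f := fun (ψ : 𝓓^{1}(Ω, EuclideanSpace ℝ (Fin d × ι)))
    (_ : ∀ x, ‖ψ x‖ ≤ 1) => ENNReal.ofReal
      (∫ x in (Ω : Set (EuclideanSpace ℝ (Fin d))), inner ℝ (u x) (divergence ψ x))) (R⁻¹ • Ψ) hn
  have hle' := (ENNReal.ofReal_le_iff_le_toReal hu.ne).1 hle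
  have hdiv : ∀ x, divergence (R⁻¹ • Ψ : 𝓓^{1}(Ω, EuclideanSpace ℝ (Fin d × ι))) x
      = R⁻¹ • divergence Ψ x := fun x => divergence_const_smul x
  simp only [hdiv, inner_smul_right, integral_const_mul] at hle'
  rwa [inv_mul_le_iff₀ hR] at hle'

/-- There is a constant `C` such that `‖w‖ ≤ C (‖φ‖ + ‖∇φ - w‖ + TV(w))`, where the norm on the left
is that of `L¹(s ∩ Ω)` and the norms on the right are those of `L¹(Ω)`. -/
def HasBoundOn (ι : Type) [Fintype ι] (Ω : Opens (EuclideanSpace ℝ (Fin d)))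
    (s : Set (EuclideanSpace ℝ (Fin d))) : Prop :=
  ∃ C : ℝ≥0, ∀ (φ : EuclideanSpace ℝ (Fin d) → EuclideanSpace ℝ ι)
    (g w : EuclideanSpace ℝ (Fin d) → EuclideanSpace ℝ (Fin d × ι)),
    MemL1 Ω φ → IsWeakGradient Ω φ g → MemBV Ω w →
      ∫⁻ x in s ∩ Ω, ‖w x‖ₑ ≤ C * (normL1 Ω φ + normL1 Ω (fun x => g x - w x) + TV Ω w)

theorem IsMollifier.hasBoundOn {ρ : EuclideanSpace ℝ (Fin d) → ℝ} {R : ℝ} (hρ : IsMollifier ρ R)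
    (hR : 0 < R) {Ω : Opens (EuclideanSpace ℝ (Fin d))} {V : Set (EuclideanSpace ℝ (Fin d))}
    (hV : IsOpen V)
    (hseg : ∀ x ∈ V ∩ Ω, ∀ z ∈ tsupport ρ, ∀ t ∈ Icc (0 : ℝ) 1, x + t • z ∈ Ω) :
    HasBoundOn ι Ω V := by
  set B : ℝ := ‖divergenceCLM d ι‖ * ∫ z, ‖fderiv ℝ ρ z‖
  have hB0 : 0 ≤ B := mul_nonneg (ContinuousLinearMap.opNorm_nonneg _) (integral_nonneg fun _ => norm_nonneg _)
  let U : Opens (EuclideanSpace ℝ (Fin d)) := ⟨V ∩ Ω, hV.inter Ω.isOpen⟩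
  have hC0 : 0 ≤ R + 1 + B := by positivity
  -- `R` is the cost of `TV(w)`, `1` that of `‖g - w‖₁`, and `B`, the bound on `|div η|`, that of
  -- `‖φ‖₁`.
  refine ⟨(R + 1 + B).toNNReal, fun φ g w hφ hg hw => ?_⟩
  have hgw : MemL1 Ω (fun x => g x - w x) := MemLp.sub hg.1 hw.1
  have hwΩ : IntegrableOn w Ω := memLp_one_iff_integrable.1 hw.1
  have hwU : IntegrableOn w U := hwΩ.mono_set inter_subset_right
  have key : ∀ ψ : 𝓓^{1}(U, EuclideanSpace ℝ (Fin d × ι)), (∀ x, ‖ψ x‖ ≤ 1) →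
      ∫ x in (U : Set (EuclideanSpace ℝ (Fin d))), inner ℝ (w x) (ψ x) ≤ (R + 1 + B) *
        ((normL1 Ω φ).toReal + (normL1 Ω (fun x => g x - w x)).toReal + (TV Ω w).toReal) := by
    intro ψ hψ1
    obtain ⟨Ψ, hΨR, hΨ⟩ := hρ.exists_testFunction_divergence (Ω := Ω) hseg ψ hψ1
    obtain ⟨η, hη, hη1, hηdiv⟩ := hρ.exists_testFunction_mollify (Ω := Ω)
      (fun x hx z hz => by simpa using hseg x hx z hz 1 ⟨zero_le_one, le_rfl⟩) ψ hψ1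
    obtain ⟨D, hD⟩ := exists_norm_divergence_le Ψ
    have hset : ∫ x in (U : Set (EuclideanSpace ℝ (Fin d))), inner ℝ (w x) (ψ x)
        = ∫ x in (Ω : Set (EuclideanSpace ℝ (Fin d))), inner ℝ (w x) (ψ x) := by
      refine (setIntegral_eq_of_subset_of_forall_sdiff_eq_zero Ω.isOpen.measurableSet
        inter_subset_right fun x hx => ?_).symm
      rw [image_eq_zero_of_notMem_tsupport (fun h => hx.2 (ψ.tsupport_subset h)), inner_zero_right]
    -- This is `ψ = div Ψ + η` with `w = g - (g - w)` in the pairing with `η`, so that the `g` term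
    -- can be integrated by parts onto `φ`.
    have hpt : ∀ x, inner ℝ (w x) (ψ x) = inner ℝ (w x) (divergence Ψ x) + inner ℝ (g x) (η x)
        - inner ℝ (g x - w x) (η x) := fun x => by
      rw [hΨ, hη, inner_sub_right, inner_sub_left]
      ring
    have i1 := integrable_inner_of_continuous hw.1 (continuous_divergence Ψ.contDiff) hD
    have i2 := integrable_inner_of_continuous hg.1 η.continuous hη1
    have i3 := integrable_inner_of_continuous hgw η.continuous hη1
    rw [hset]
    simp only [hpt]
    rw [integral_sub (by exact i1.add i2) i3, integral_add i1 i2]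
    have e1 := integral_inner_divergence_le hw.2 hR Ψ hΨR
    have e2 := hg.2 η
    have e3 := integral_inner_le_mul_integral_norm hφ hηdiv
    have e4 := integral_inner_le_mul_integral_norm hgw hη1
    have e5 := neg_abs_le (∫ x in (Ω : Set (EuclideanSpace ℝ (Fin d))),
      inner ℝ (φ x) (divergence η x))
    have e6 := neg_abs_le (∫ x in (Ω : Set (EuclideanSpace ℝ (Fin d))),
      inner ℝ (g x - w x) (η x))
    have p1 : 0 ≤ (normL1 Ω φ).toReal := ENNReal.toReal_nonneg
    have p2 : 0 ≤ (normL1 Ω (fun x => g x - w x)).toReal := ENNReal.toReal_nonneg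
    have p3 : 0 ≤ (TV Ω w).toReal := ENNReal.toReal_nonneg
    nlinarith [mul_nonneg hR.le p1, mul_nonneg hR.le p2, mul_nonneg hB0 p2, mul_nonneg hB0 p3]
  have h := eLpNorm_one_le_of_forall_testFunction hwU key
  rw [eLpNorm_one_eq_lintegral_enorm] at h
  refine h.trans_eq ?_
  rw [ENNReal.ofReal_mul hC0, ENNReal.ofReal_add (by positivity) ENNReal.toReal_nonneg,
    ENNReal.ofReal_add ENNReal.toReal_nonneg ENNReal.toReal_nonneg,
    ENNReal.ofReal_toReal (a := normL1 Ω φ) hφ.2.ne,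
    ENNReal.ofReal_toReal (a := normL1 Ω fun x => g x - w x) hgw.2.ne,
    ENNReal.ofReal_toReal hw.2.ne]
  rfl

theorem exists_isMollifier (v : EuclideanSpace ℝ (Fin d)) {ε : ℝ} (hε : 0 < ε) :
    ∃ ρ : EuclideanSpace ℝ (Fin d) → ℝ, IsMollifier ρ (‖v‖ + ε) ∧ tsupport ρ = closedBall v ε := by
  let b : ContDiffBump v := ⟨ε / 2, ε, by positivity, by linarith⟩
  have hts : tsupport (b.normed volume) = closedBall v ε := b.tsupport_normed_eq
  refine ⟨b.normed volume, ⟨b.contDiff_normed (n := 1), b.hasCompactSupport_normed,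
    b.nonneg_normed, b.integral_normed, ?_⟩, hts⟩
  rw [hts]
  refine closedBall_subset_closedBall' ?_
  rw [dist_zero_right, add_comm]

/-- `Ω` contains the segments from the points of `V ∩ Ω` in the directions of a fixed ball. -/
def HasSegmentProperty (Ω : Opens (EuclideanSpace ℝ (Fin d)))
    (V : Set (EuclideanSpace ℝ (Fin d))) : Prop :=
  ∃ (v : EuclideanSpace ℝ (Fin d)) (ε : ℝ), 0 < ε ∧
    ∀ x ∈ V ∩ Ω, ∀ z ∈ closedBall v ε, ∀ t ∈ Icc (0 : ℝ) 1, x + t • z ∈ Ω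

theorem HasSegmentProperty.hasBoundOn {Ω : Opens (EuclideanSpace ℝ (Fin d))}
    {V : Set (EuclideanSpace ℝ (Fin d))} (h : HasSegmentProperty Ω V) (hV : IsOpen V) :
    HasBoundOn ι Ω V := by
  obtain ⟨v, ε, hε, h⟩ := h
  obtain ⟨ρ, hρ, hts⟩ := exists_isMollifier v hε
  exact hρ.hasBoundOn (by positivity) hV (by rwa [hts])

/-- Such bounds pass to subsets and add up over finite unions, so compactness reduces them to small
balls. -/
theorem hasBoundOn_of_isCompact {Ω : Opens (EuclideanSpace ℝ (Fin d))}
    {K : Set (EuclideanSpace ℝ (Fin d))} (hK : IsCompact K)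
    (h : ∀ x ∈ K, ∃ r > 0, HasSegmentProperty Ω (ball x r)) : HasBoundOn ι Ω K := by
  refine hK.induction_on (p := HasBoundOn ι Ω) ⟨0, fun φ g w _ _ _ => by simp⟩ ?_ ?_ ?_
  · rintro s t hst ⟨C, hC⟩
    exact ⟨C, fun φ g w hφ hg hw => (lintegral_mono_set (inter_subset_inter_left _ hst)).trans
      (hC φ g w hφ hg hw)⟩
  · rintro s t ⟨C, hC⟩ ⟨C', hC'⟩
    refine ⟨C + C', fun φ g w hφ hg hw => ?_⟩
    rw [union_inter_distrib_right, ENNReal.coe_add, add_mul]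
    exact (lintegral_union_le _ _ _).trans
      (add_le_add (hC φ g w hφ hg hw) (hC' φ g w hφ hg hw))
  · intro x hx
    obtain ⟨r, hr, h⟩ := h x hx
    exact ⟨ball x r, mem_nhdsWithin_of_mem_nhds (ball_mem_nhds x hr), h.hasBoundOn isOpen_ball⟩

end Estimate

/-! ### Segments in a Lipschitz domain -/

section Lipschitz

theorem hasSegmentProperty_of_mem {d : ℕ} {Ω : Opens (EuclideanSpace ℝ (Fin d))}
    {x : EuclideanSpace ℝ (Fin d)} (hx : x ∈ Ω) : ∃ r > 0, HasSegmentProperty Ω (ball x r) := by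
  obtain ⟨r, hr, hrΩ⟩ := Metric.isOpen_iff.1 Ω.isOpen x hx
  refine ⟨r / 2, by positivity, 0, r / 2, by positivity, fun y hy z hz t ht => hrΩ ?_⟩
  have h1 : dist y x < r / 2 := hy.1
  have h2 : ‖t • z‖ ≤ r / 2 := by
    rw [norm_smul, Real.norm_of_nonneg ht.1]
    exact (mul_le_of_le_one_left (norm_nonneg _) ht.2).trans (mem_closedBall_zero_iff.1 hz)
  rw [mem_ball, dist_eq_norm] at *
  have h3 := norm_add_le (y - x) (t • z)
  rw [show y + t • z - x = y - x + t • z by abel]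
  linarith

/-- A region above a `K`-Lipschitz graph is stable under moves in the upward cone of slope `K`; a
ball about an upward vector fits into that cone. -/
theorem HasLipschitzBoundary.hasSegmentProperty {Ω : Opens (EuclideanSpace ℝ (Fin 2))}
    (hΩ : HasLipschitzBoundary Ω) {x₀ : EuclideanSpace ℝ (Fin 2)}
    (hx₀ : x₀ ∈ frontier (Ω : Set (EuclideanSpace ℝ (Fin 2)))) :
    ∃ r > 0, HasSegmentProperty Ω (ball x₀ r) := by
  obtain ⟨A, γ, K, r, hγ, hr, hA⟩ := hΩ x₀ hx₀
  have hK : (0 : ℝ) ≤ K := K.2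
  -- As `ε ≤ h`, moves have length at most `2 * h = r / 4`, so points of the ball of radius `r / 2`
  -- stay in the chart.
  set h : ℝ := r / 8 with hh
  have hh0 : 0 < h := by positivity
  -- Chosen so that `K * ε = h - ε`: the most the graph can rise equals the least the point rises.
  -- The inequality stays strict because it is strict at `y`.
  set ε : ℝ := h / (K + 1) with hε
  have hε0 : 0 < ε := by positivity
  have hεh : (K + 1) * ε = h := by rw [hε]; field_simp
  set e : EuclideanSpace ℝ (Fin 2) := EuclideanSpace.single 1 1 with he
  refine ⟨r / 2, by positivity, A.symm (h • e), ε, hε0, fun y hy z hz t ht => ?_⟩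
  have hyr : dist y x₀ < r / 2 := hy.1
  have hyr' : y ∈ ball x₀ r := ball_subset_ball (by linarith) hy.1
  have hAz : ‖A z - h • e‖ ≤ ε := by
    rw [← A.apply_symm_apply (h • e), ← map_sub, A.norm_map, ← dist_eq_norm]
    exact hz
  have hc : ∀ i, |A z i - (h • e) i| ≤ ε := fun i =>
    (PiLp.norm_apply_le (A z - h • e) i).trans hAz
  have h0 : |A z 0| ≤ ε := by simpa [he] using hc 0
  have h1 : |A z 1 - h| ≤ ε := by simpa [he] using hc 1
  have hz2 : ‖z‖ ≤ h + ε := by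
    have hn : ‖h • e‖ = h := by simp [he, norm_smul, abs_of_pos hh0]
    have := norm_add_le (A z - h • e) (h • e)
    rw [sub_add_cancel, A.norm_map, hn] at this
    linarith
  have htz : ‖t • z‖ ≤ h + ε := by
    rw [norm_smul, Real.norm_of_nonneg ht.1]
    exact (mul_le_of_le_one_left (norm_nonneg _) ht.2).trans hz2
  have hεle : ε ≤ h := by nlinarith
  have hmem : y + t • z ∈ ball x₀ r := by
    rw [mem_ball, dist_eq_norm, show y + t • z - x₀ = y - x₀ + t • z by abel]
    rw [dist_eq_norm] at hyr
    have := norm_add_le (y - x₀) (t • z)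
    linarith
  refine (hA _ hmem).2 ?_
  have hyA := (hA y hyr').1 hy.2
  have hsum : ∀ i, A (y + t • z) i = A y i + t * A z i := fun i => by simp
  rw [hsum, hsum]
  have hlip : γ (A y 0 + t * A z 0) ≤ γ (A y 0) + K * (t * ε) := by
    have hd := hγ.dist_le_mul (A y 0 + t * A z 0) (A y 0)
    rw [Real.dist_eq, Real.dist_eq, add_sub_cancel_left, abs_mul, abs_of_nonneg ht.1] at hd
    have := mul_le_mul_of_nonneg_left (mul_le_mul_of_nonneg_left h0 ht.1) hK
    linarith [le_abs_self (γ (A y 0 + t * A z 0) - γ (A y 0))]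
  have h1' : t * (h - ε) ≤ t * A z 1 :=
    mul_le_mul_of_nonneg_left (by linarith [(abs_le.1 h1).1]) ht.1
  have : K * (t * ε) = t * (h - ε) := by rw [← hεh]; ring
  linarith

theorem IsBoundedLipschitzDomain.hasBoundOn (ι : Type) [Fintype ι]
    {Ω : Opens (EuclideanSpace ℝ (Fin 2))} (hΩ : IsBoundedLipschitzDomain Ω) :
    HasBoundOn ι Ω Ω := by
  have hK : IsCompact (closure (Ω : Set (EuclideanSpace ℝ (Fin 2)))) :=
    hΩ.isBounded.isCompact_closure
  obtain ⟨C, hC⟩ := hasBoundOn_of_isCompact (ι := ι) (Ω := Ω) hK fun x hx => by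
    by_cases hxΩ : x ∈ Ω
    · exact hasSegmentProperty_of_mem hxΩ
    · refine hΩ.lipschitzBoundary.hasSegmentProperty ⟨hx, ?_⟩
      rwa [Ω.isOpen.interior_eq]
  refine ⟨C, fun φ g w hφ hg hw => (lintegral_mono_set ?_).trans (hC φ g w hφ hg hw)⟩
  exact inter_subset_inter_left _ subset_closure

end Lipschitz

/-! ### From the bound on `w` to the `W^{1,1}` norm -/

theorem IsBoundedLipschitzDomain.exists_normW11_le (ι : Type) [Fintype ι]
    {Ω : Opens (EuclideanSpace ℝ (Fin 2))} (hΩ : IsBoundedLipschitzDomain Ω) :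
    ∃ C : ℝ≥0, 0 < C ∧ ∀ (φ : EuclideanSpace ℝ (Fin 2) → EuclideanSpace ℝ ι)
      (w : EuclideanSpace ℝ (Fin 2) → EuclideanSpace ℝ (Fin 2 × ι)),
      MemW11 Ω φ → MemBV Ω w → normW11 Ω φ ≤
        C * (normL1 Ω φ + normL1 Ω (fun x => weakGradient Ω φ x - w x) + TV Ω w) := by
  obtain ⟨C, hC⟩ := hΩ.hasBoundOn ι
  refine ⟨C + 1, by positivity, fun φ w hφ hw => ?_⟩
  have hg := hφ.isWeakGradient
  have h := hC φ (weakGradient Ω φ) w hφ.1 hg hw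
  rw [inter_self, ← eLpNorm_one_eq_lintegral_enorm] at h
  have htri : normL1 Ω (weakGradient Ω φ)
      ≤ normL1 Ω (fun x => weakGradient Ω φ x - w x) + normL1 Ω w := by
    have := eLpNorm_add_le (hg.1.1.sub hw.1.1) hw.1.1 le_rfl
    rwa [sub_add_cancel] at this
  calc normW11 Ω φ
      ≤ normL1 Ω φ + (normL1 Ω (fun x => weakGradient Ω φ x - w x) + C *
          (normL1 Ω φ + normL1 Ω (fun x => weakGradient Ω φ x - w x) + TV Ω w)) :=
        add_le_add le_rfl (htri.trans (add_le_add le_rfl h))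
    _ ≤ (normL1 Ω φ + normL1 Ω (fun x => weakGradient Ω φ x - w x) + TV Ω w) + C *
          (normL1 Ω φ + normL1 Ω (fun x => weakGradient Ω φ x - w x) + TV Ω w) := by
        rw [← add_assoc]
        exact add_le_add le_self_add le_rfl
    _ = _ := by push_cast; ring

end BVPlane

end

theorem lemma3p5 (Ω : TopologicalSpace.Opens (EuclideanSpace ℝ (Fin 2)))
    (hΩ : BVPlane.IsBoundedLipschitzDomain Ω) :
    ∃ C : ℝ≥0, 0 < C ∧
      (∀ (φ : EuclideanSpace ℝ (Fin 2) → EuclideanSpace ℝ (Fin 2))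
          (w : EuclideanSpace ℝ (Fin 2) → EuclideanSpace ℝ (Fin 2 × Fin 2)),
        BVPlane.MemBV2 Ω φ → BVPlane.MemBV Ω w →
          BVPlane.normW11 Ω φ ≤
            C * (BVPlane.normL1 Ω φ
              + BVPlane.normL1 Ω (fun x => BVPlane.weakGradient Ω φ x - w x)
              + BVPlane.TV Ω w)) ∧
      (∀ φ : EuclideanSpace ℝ (Fin 2) → EuclideanSpace ℝ (Fin 2),
        BVPlane.MemBV2 Ω φ →
          BVPlane.normW11 Ω φ ≤
            C * (BVPlane.normL1 Ω φ + BVPlane.TV Ω (BVPlane.weakGradient Ω φ))) := by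
  obtain ⟨C, hC, h⟩ := hΩ.exists_normW11_le (Fin 2)
  refine ⟨C, hC, fun φ w hφ hw => h φ w hφ.1 hw, fun φ hφ => ?_⟩
  -- Here `w` is the weak gradient itself, so the middle term vanishes.
  simpa [BVPlane.normL1] using h φ _ hφ.1 hφ.2
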